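/- For graphs $G,H$ and an integer $q\ge 1$ write $G\to_q H$ if every colouring of the edges of $G$ with $q$ colours contains a monochromatic (not necessarily induced) copy of $H$. Let $kK_2$ denote a matching with $k$ edges, and let $\nu_q(G)$ be the largest integer $k\ge 0$ such that $G\to_q kK_2$. For $q\ge 1$ and $\alpha\in[0,1]$ put \[ \mathfrak{s}_q(\alpha)=\frac{1-\sqrt{1-\alpha}}{q},\qquad \mathfrak{d}_q(\alpha)=\lim_{x\to q}\frac{x-1-\sqrt{1-2x+x^2-\alpha(x^2-2x-3)}}{x^2-2x-3} \] (the limit is only needed for $q=3$, where the singularity is removable). **Theorem.** Let $q\ge 1$ be an integer. There is a function $e_q:\mathbb{N}\to\mathbb{R}$ with $e_q(n)=o(n)$ as $n\to\infty$ such that for every $\alpha\in[0,1]$ and every graph $G$ on $n$ vertices with exactly $\alpha\binom n2$ edges, \[ \nu_q(G)\ \ge\ \min\{\mathfrak{s}_q(\alpha),\mathfrak{d}_q(\alpha)\}\cdot n-e_q(n). \] -/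

import Mathlib

open Filter Topology

namespace MatchingRamsey

/-- The matching `k K₂`: the disjoint union of `k` edges. -/
def matchingGraph (k : ℕ) : SimpleGraph (Fin k × Bool) where
  Adj a b := a.1 = b.1 ∧ a.2 ≠ b.2
  symm := ⟨fun _ _ h => ⟨h.1.symm, h.2.symm⟩⟩
  loopless := ⟨fun _ h => h.2 rfl⟩

/-- `G →_q H`: every colouring of the edges of `G` with `q` colours has a monochromatic
(not necessarily induced) copy of `H`. -/
def Arrows {V W : Type*} (G : SimpleGraph V) (q : ℕ) (H : SimpleGraph W) : Prop :=
  ∀ C : G.EdgeLabeling (Fin q), ∃ j : Fin q, H.IsContained (C.labelGraph j)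

/-- `ν_q(G)`: the largest `k` such that `G →_q k K₂`. -/
noncomputable def nu {V : Type*} (q : ℕ) (G : SimpleGraph V) : ℕ :=
  sSup {k : ℕ | Arrows G q (matchingGraph k)}

/-- For a finite graph and at least one colour the largest such `k` exists. -/
theorem isGreatest_nu {V : Type*} [Finite V] (q : ℕ) (hq : 1 ≤ q) (G : SimpleGraph V) :
    IsGreatest {k : ℕ | Arrows G q (matchingGraph k)} (nu q G) := by
  have hne : {k : ℕ | Arrows G q (matchingGraph k)}.Nonempty :=
    ⟨0, fun C => ⟨⟨0, hq⟩, SimpleGraph.IsContained.of_isEmpty⟩⟩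
  have hbd : BddAbove {k : ℕ | Arrows G q (matchingGraph k)} := by
    refine ⟨Nat.card V, fun k hk => ?_⟩
    obtain ⟨j, ⟨f⟩⟩ := hk (fun _ => ⟨0, hq⟩)
    have h := Nat.card_le_card_of_injective f f.injective
    rw [Nat.card_prod, Nat.card_fin, Nat.card_eq_fintype_card (α := Bool), Fintype.card_bool] at h
    omega
  exact ⟨Nat.sSup_mem hne hbd, fun k hk => le_csSup hbd hk⟩

/-- `𝔰_q(α) = (1 - √(1 - α)) / q`. -/
noncomputable def sparse (q : ℕ) (α : ℝ) : ℝ := (1 - √(1 - α)) / q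

/-- The algebraic expression whose limit as `x → q` is `𝔡_q(α)`. -/
noncomputable def denseExpr (α x : ℝ) : ℝ :=
  (x - 1 - √(1 - 2 * x + x ^ 2 - α * (x ^ 2 - 2 * x - 3))) / (x ^ 2 - 2 * x - 3)

/-- `𝔡_q(α) = lim_{x → q} denseExpr α x`, the limit being over `x ≠ q`. -/
noncomputable def dense (q : ℕ) (α : ℝ) : ℝ :=
  limUnder (𝓝[≠] (q : ℝ)) (denseExpr α)

/-- The value at `x = q` if `q ≠ 3`, and the value at the removable singularity if `q = 3`. -/
theorem tendsto_denseExpr_explicit (q : ℕ) (α : ℝ) :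
    Tendsto (denseExpr α) (𝓝[≠] (q : ℝ)) (𝓝 (if q = 3 then α / 4 else denseExpr α q)) := by
  split_ifs with h
  · subst h
    have hc : ContinuousAt
        (fun x : ℝ => α / (x - 1 + √(1 - 2 * x + x ^ 2 - α * (x ^ 2 - 2 * x - 3)))) 3 := by
      refine ContinuousAt.div (by fun_prop) (by fun_prop) ?_
      have : (0 : ℝ) ≤ √(1 - 2 * 3 + 3 ^ 2 - α * (3 ^ 2 - 2 * 3 - 3)) := Real.sqrt_nonneg _
      intro h0
      linarith
    have hr : ContinuousAt (fun x : ℝ => 1 - 2 * x + x ^ 2 - α * (x ^ 2 - 2 * x - 3)) 3 := by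
      fun_prop
    have hpos : ∀ᶠ x in 𝓝 (3 : ℝ), 0 < 1 - 2 * x + x ^ 2 - α * (x ^ 2 - 2 * x - 3) :=
      hr.eventually (lt_mem_nhds (by norm_num))
    have hv : √(1 - 2 * 3 + 3 ^ 2 - α * (3 ^ 2 - 2 * 3 - 3)) = 2 := by
      rw [show (1 - 2 * 3 + 3 ^ 2 - α * (3 ^ 2 - 2 * 3 - 3) : ℝ) = 2 ^ 2 by ring]
      exact Real.sqrt_sq (by norm_num)
    have ht := hc.tendsto
    rw [hv] at ht
    norm_num at ht
    push_cast
    refine (ht.mono_left nhdsWithin_le_nhds).congr' ?_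
    filter_upwards [self_mem_nhdsWithin, nhdsWithin_le_nhds hpos,
      nhdsWithin_le_nhds (lt_mem_nhds (show (1 : ℝ) < 3 by norm_num))] with x hx hp h1
    have hx3 : x - 3 ≠ 0 := sub_ne_zero.mpr hx
    have hx1 : x + 1 ≠ 0 := by linarith
    have hd : x ^ 2 - 2 * x - 3 ≠ 0 := by
      rw [show x ^ 2 - 2 * x - 3 = (x - 3) * (x + 1) by ring]
      exact mul_ne_zero hx3 hx1
    have hs := Real.sq_sqrt hp.le
    have hs0 := Real.sqrt_nonneg (1 - 2 * x + x ^ 2 - α * (x ^ 2 - 2 * x - 3))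
    unfold denseExpr
    rw [div_eq_div_iff (by linarith) hd]
    linear_combination hs
  · have hd : (q : ℝ) ^ 2 - 2 * q - 3 ≠ 0 := by
      rw [show (q : ℝ) ^ 2 - 2 * q - 3 = (q - 3) * (q + 1) by ring]
      refine mul_ne_zero (sub_ne_zero.mpr (by exact_mod_cast h)) (by positivity)
    have hc : ContinuousAt (denseExpr α) q := by
      unfold denseExpr
      exact ContinuousAt.div (by fun_prop) (by fun_prop) hd
    exact hc.tendsto.mono_left nhdsWithin_le_nhds

/-- The limit in the definition of `dense` exists. -/
theorem tendsto_dense (q : ℕ) (α : ℝ) :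
    Tendsto (denseExpr α) (𝓝[≠] (q : ℝ)) (𝓝 (dense q α)) :=
  tendsto_nhds_limUnder ⟨_, tendsto_denseExpr_explicit q α⟩

end MatchingRamsey

/-! Let `k` be `nu q G` and `n` the number of vertices. Some colouring has no monochromatic matching
of size `k + 1`. By a Tutte–Berge argument (`exists_cover_of_not_isContained`) each colour `i` then
has a set of `s i ≤ k` vertices outside which it spans at most about `2 (k - s i) ^ 2` edges.
Counting the edges that meet one of these sets separately bounds the density of `G`
(`exists_edge_bound`).

With `x = k / n` and `t i = (k - s i) / n`, the bound is largest either when all `t i` vanish or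
when a single `t i` equals `x` (`sum_sq_bound`); these cases give `sparseEdges q x` and `denseEdges
q x`. Hence `α` is at most the larger of the two, up to `O(1/n)`. Both functions grow at least
quadratically and take the value `α` at `sparse q α` and `dense q α`, so inverting them costs
`O(√n)` in `k`. -/

namespace MatchingRamsey

/-! ### Covers of graphs without large matchings, from Tutte's theorem -/

/-- A graph with many components has few adjacent pairs. -/
theorem card_adj_le_sq {U : Type*} [Finite U] (K : SimpleGraph U) (m : ℕ)
    (h : Nat.card U + 1 ≤ m + Nat.card K.ConnectedComponent) :
    {p : U × U | K.Adj p.1 p.2}.ncard ≤ m ^ 2 := by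
  classical
  let rep : K.ConnectedComponent → U := Quot.out
  have hrep : ∀ c, K.connectedComponentMk (rep c) = c := fun c => Quot.out_eq c
  have hinj : Function.Injective rep := Function.LeftInverse.injective hrep
  let N : Set U := (Set.range rep)ᶜ
  -- All representatives collapse to `none`. An adjacent pair contains at most one of them, and the
  -- other endpoint determines its component, so the images under `φ` still determine the pair.
  let φ : U → Option N := fun u => if hu : u ∈ N then some ⟨u, hu⟩ else none
  have hφ : ∀ u v, φ u = φ v → K.connectedComponentMk u = K.connectedComponentMk v → u = v := by
    intro u v huv hc
    by_cases hu : u ∈ N <;> by_cases hv : v ∈ N <;> simp only [φ, hu, hv, dite_true, dite_false] at huv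
    · simpa using huv
    · simp at huv
    · simp at huv
    · simp only [N, Set.mem_compl_iff, not_not] at hu hv
      obtain ⟨c, rfl⟩ := hu
      obtain ⟨d, rfl⟩ := hv
      rw [hrep, hrep] at hc
      rw [hc]
  have hφN : ∀ u v, φ u = φ v → u = v ∨ (u ∉ N ∧ v ∉ N) := by
    intro u v huv
    by_cases hu : u ∈ N <;> by_cases hv : v ∈ N <;> simp only [φ, hu, hv, dite_true, dite_false] at huv
    · exact Or.inl (by simpa using huv)
    · simp at huv
    · simp at huv
    · exact Or.inr ⟨hu, hv⟩
  have hcc : ∀ {u v}, K.Adj u v → K.connectedComponentMk u = K.connectedComponentMk v :=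
    fun h => SimpleGraph.ConnectedComponent.sound h.reachable
  have hcardN : Nat.card (Option N) ≤ m := by
    have h1 : N.ncard + (Set.range rep).ncard = Nat.card U := by
      rw [add_comm]; exact Set.ncard_add_ncard_compl _
    have h2 : (Set.range rep).ncard = Nat.card K.ConnectedComponent := by
      rw [← Set.image_univ, Set.ncard_image_of_injective _ hinj, Set.ncard_univ]
    have h3 : Nat.card (Option N) = N.ncard + 1 := by
      rw [Finite.card_option, Nat.card_coe_set_eq]
    omega
  calc {p : U × U | K.Adj p.1 p.2}.ncard
      ≤ (Set.univ : Set (Option N × Option N)).ncard := by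
        refine Set.ncard_le_ncard_of_injOn (fun p => (φ p.1, φ p.2)) (fun _ _ => Set.mem_univ _) ?_
        rintro ⟨u, v⟩ huv ⟨u', v'⟩ huv' heq
        simp only [Set.mem_ofPred_eq] at huv huv'
        obtain ⟨h1, h2⟩ := Prod.mk.inj heq
        have e1 := hcc huv
        have e2 := hcc huv'
        rcases hφN _ _ h1 with rfl | ⟨hu, hu'⟩
        · rw [hφ v v' h2 (by rw [← e1, e2])]
        · rcases hφN _ _ h2 with rfl | ⟨hv, hv'⟩
          · rw [hφ u u' h1 (by rw [e1, e2])]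
          · refine absurd (hφ u v ?_ e1) huv.ne
            simp only [φ, hu, hv, dite_false]
    _ = Nat.card (Option N) ^ 2 := by rw [Set.ncard_univ, Nat.card_prod, sq]
    _ ≤ m ^ 2 := Nat.pow_le_pow_left hcardN 2

/-- The pairs `{a, f a}` are disjoint edges, and each arises from at most two elements of `A`. -/
theorem matchingGraph_isContained_of_involution {V : Type*} [Finite V] (H : SimpleGraph V)
    (A : Set V) (f : V → V) (hadj : ∀ a ∈ A, H.Adj a (f a)) (hinv : ∀ a ∈ A, f (f a) = a)
    (k : ℕ) (hk : 2 * k ≤ A.ncard) : (matchingGraph k).IsContained H := by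
  classical
  have := Fintype.ofFinite V
  let e : V → Sym2 V := fun a => s(a, f a)
  have hcard : k ≤ (A.toFinset.image e).card := by
    have h1 : A.toFinset.card ≤ 2 * (A.toFinset.image e).card := by
      refine Finset.card_le_mul_card_image _ _ fun b hb => ?_
      obtain ⟨a, -, rfl⟩ := Finset.mem_image.1 hb
      refine (Finset.card_le_card (t := {a, f a}) fun c hc => ?_).trans Finset.card_le_two
      have hc' := (Finset.mem_filter.1 hc).2
      simp only [e, Sym2.eq_iff] at hc'
      simp only [Finset.mem_insert, Finset.mem_singleton]
      tauto
    rw [Set.ncard_eq_toFinset_card'] at hk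
    omega
  obtain ⟨g⟩ : Nonempty (Fin k ↪ (A.toFinset.image e : Finset (Sym2 V))) :=
    Function.Embedding.nonempty_of_card_le (by rwa [Fintype.card_fin, Fintype.card_coe])
  have hg : ∀ j, ∃ a ∈ A, e a = g j := fun j => by
    obtain ⟨a, ha, h⟩ := Finset.mem_image.1 (g j).2
    exact ⟨a, Set.mem_toFinset.1 ha, h⟩
  choose a haA hae using hg
  have hinj : ∀ i j, e (a i) = e (a j) → i = j := fun i j h =>
    g.injective (Subtype.ext (by rw [← hae, ← hae, h]))
  let F : Fin k × Bool → V := fun x => if x.2 then a x.1 else f (a x.1)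
  have hFe : ∀ x, e (F x) = e (a x.1) := by
    rintro ⟨j, b⟩
    cases b
    · change s(f (a j), f (f (a j))) = s(a j, f (a j))
      rw [hinv _ (haA j), Sym2.eq_swap]
    · rfl
  refine ⟨⟨F, ?_⟩, ?_⟩
  · rintro ⟨i, b⟩ ⟨j, c⟩ ⟨h1, h2⟩
    simp only at h1 h2
    subst h1
    cases b <;> cases c
    · exact absurd rfl h2
    · exact (hadj _ (haA i)).symm
    · exact hadj _ (haA i)
    · exact absurd rfl h2
  · rintro ⟨i, b⟩ ⟨j, c⟩ h
    have hij : i = j := hinj i j (by rw [← hFe (i, b), ← hFe (j, c)]; exact congrArg e h)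
    subst hij
    have hne := (hadj _ (haA i)).ne
    cases b <;> cases c
    · rfl
    · exact absurd h.symm hne
    · exact absurd h hne
    · rfl

/-- The join of `G` with a complete graph on `W`. -/
def joinComplete {V : Type*} (G : SimpleGraph V) (W : Type*) : SimpleGraph (V ⊕ W) where
  Adj a b := a ≠ b ∧ ∀ u v, a = Sum.inl u → b = Sum.inl v → G.Adj u v
  symm := ⟨fun _ _ h => ⟨h.1.symm, fun u v hu hv => (h.2 v u hv hu).symm⟩⟩
  loopless := ⟨fun _ h => h.1 rfl⟩

theorem joinComplete_adj_inl {V W : Type*} {G : SimpleGraph V} {u v : V} :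
    (joinComplete G W).Adj (Sum.inl u) (Sum.inl v) ↔ G.Adj u v := by
  constructor
  · exact fun h => h.2 u v rfl rfl
  · refine fun h => ⟨fun h' => h.ne (Sum.inl_injective h'), fun a b ha hb => ?_⟩
    rw [← Sum.inl_injective ha, ← Sum.inl_injective hb]
    exact h

/-- A perfect matching of the join restricts to a large matching of `G`. -/
theorem matchingGraph_isContained_of_joinComplete {V W : Type*} [Finite V] [Finite W]
    (G : SimpleGraph V) (M : (joinComplete G W).Subgraph) (hM : M.IsPerfectMatching) (k : ℕ)
    (hk : 2 * k + Nat.card W ≤ Nat.card V) : (matchingGraph k).IsContained G := by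
  classical
  rw [SimpleGraph.Subgraph.isPerfectMatching_iff] at hM
  choose f hf hfu using hM
  have hff : ∀ a, f (f a) = a := fun a => (hfu (f a) a (hf a).symm).symm
  have hinj : Function.Injective f := Function.LeftInverse.injective hff
  -- The value `v` is a default, taken only when `v` is matched into `W`.
  let g : V → V := fun v => Sum.elim id (fun _ => v) (f (Sum.inl v))
  let A : Set V := {v | ∃ u, f (Sum.inl v) = Sum.inl u}
  have hg : ∀ v ∈ A, f (Sum.inl v) = Sum.inl (g v) := by
    rintro v ⟨u, hu⟩
    simp [g, hu]
  refine matchingGraph_isContained_of_involution G A g (fun v hv => ?_) (fun v hv => ?_) k ?_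
  · have h := (hf (Sum.inl v)).adj_sub
    rw [hg v hv] at h
    exact joinComplete_adj_inl.1 h
  · have h1 : f (Sum.inl (g v)) = Sum.inl v := by rw [← hg v hv, hff]
    exact Sum.inl_injective ((hg (g v) ⟨v, h1⟩).symm.trans h1)
  · have h1 : A.ncard + Aᶜ.ncard = Nat.card V := Set.ncard_add_ncard_compl _
    have h2 : Aᶜ.ncard ≤ (Set.range (Sum.inr : W → V ⊕ W)).ncard := by
      refine Set.ncard_le_ncard_of_injOn (fun v => f (Sum.inl v)) (fun v hv => ?_)
        (fun a _ b _ h => Sum.inl_injective (hinj h))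
      rcases h : f (Sum.inl v) with u | w
      · exact absurd ⟨u, h⟩ hv
      · exact ⟨w, rfl⟩
    have h3 : (Set.range (Sum.inr : W → V ⊕ W)).ncard = Nat.card W := by
      rw [← Set.image_univ, Set.ncard_image_of_injective _ Sum.inr_injective, Set.ncard_univ]
    omega

/-- A quantitative consequence of the Tutte–Berge formula: a graph without a matching of size
`k + 1` has few edges outside a small set of vertices. -/
theorem exists_cover_of_not_isContained {V : Type*} [Finite V] (G : SimpleGraph V) (k : ℕ)
    (h : ¬ (matchingGraph (k + 1)).IsContained G) :
    ∃ S : Set V, S.ncard ≤ k ∧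
      {p : V × V | G.Adj p.1 p.2 ∧ p.1 ∉ S ∧ p.2 ∉ S}.ncard ≤ (2 * (k - S.ncard) + 2) ^ 2 := by
  classical
  have := Fintype.ofFinite V
  rcases lt_or_ge (Nat.card V) (2 * k + 2) with hn | hn
  · refine ⟨∅, by simp, ?_⟩
    calc _ ≤ (Set.univ : Set (V × V)).ncard := Set.ncard_le_ncard (Set.subset_univ _)
      _ = Nat.card V ^ 2 := by rw [Set.ncard_univ, Nat.card_prod, sq]
      _ ≤ _ := Nat.pow_le_pow_left (by rw [Set.ncard_empty]; omega) 2
  -- A matching of size `k + 1` leaves `d` vertices uncovered, so `d` universal vertices are added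
  -- to absorb them. The join has the even order `2 * (k + 1 + d)`.
  obtain ⟨d, hd⟩ := Nat.exists_eq_add_of_le hn
  have hno : ¬ ∃ M : (joinComplete G (Fin d)).Subgraph, M.IsPerfectMatching := by
    rintro ⟨M, hM⟩
    refine h (matchingGraph_isContained_of_joinComplete G M hM (k + 1) ?_)
    rw [Nat.card_fin]
    omega
  rw [SimpleGraph.tutte] at hno
  push Not at hno
  obtain ⟨T, hT⟩ := hno
  have hcardVW : Nat.card (V ⊕ Fin d) = Nat.card V + d := by rw [Nat.card_sum, Nat.card_fin]
  unfold SimpleGraph.IsTutteViolator at hT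
  set K := ((⊤ : (joinComplete G (Fin d)).Subgraph).deleteVerts T).coe with hK
  have hodd : K.oddComponents.ncard ≤ Nat.card K.ConnectedComponent := by
    rw [← Set.ncard_univ]
    exact Set.ncard_le_ncard (Set.subset_univ _)
  have hKcard : Nat.card ((⊤ : (joinComplete G (Fin d)).Subgraph).deleteVerts T).verts + T.ncard
      = Nat.card V + d := by
    rw [← hcardVW, Nat.card_coe_set_eq, SimpleGraph.Subgraph.deleteVerts_verts,
      SimpleGraph.Subgraph.verts_top, ← Set.compl_eq_univ_sdiff, add_comm]
    exact Set.ncard_add_ncard_compl _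
  have hcc : Nat.card K.ConnectedComponent ≤
      Nat.card ((⊤ : (joinComplete G (Fin d)).Subgraph).deleteVerts T).verts :=
    Nat.card_le_card_of_surjective K.connectedComponentMk (fun c => c.exists_rep)
  -- A surviving universal vertex makes `K` connected. The violator is then empty and `K` is a
  -- single odd component, against the even order.
  have hW : ∀ w : Fin d, Sum.inr w ∈ T := by
    intro w
    by_contra hw
    let w' : ((⊤ : (joinComplete G (Fin d)).Subgraph).deleteVerts T).verts :=
      ⟨Sum.inr w, trivial, hw⟩
    have hreach : ∀ a, K.Reachable a w' := by
      intro a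
      by_cases ha : a = w'
      · rw [ha]
      · refine SimpleGraph.Adj.reachable ?_
        rw [hK, SimpleGraph.Subgraph.coe_adj, SimpleGraph.Subgraph.deleteVerts_adj]
        refine ⟨trivial, a.2.2, trivial, hw, fun h => ha (Subtype.ext h), fun _ v _ hv => ?_⟩
        exact absurd hv Sum.inr_ne_inl
    have hle : Nat.card K.ConnectedComponent ≤ 1 := by
      have : Subsingleton K.ConnectedComponent := by
        refine ⟨fun c e => ?_⟩
        induction c using SimpleGraph.ConnectedComponent.ind
        induction e using SimpleGraph.ConnectedComponent.ind
        exact SimpleGraph.ConnectedComponent.sound ((hreach _).trans (hreach _).symm)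
      exact Finite.card_le_one_iff_subsingleton.2 this
    have h1 : K.oddComponents.ncard = 1 := by omega
    have h2 := SimpleGraph.odd_ncard_oddComponents (G := K)
    rw [h1, show Nat.card _ = 2 * (k + 1 + d) by omega] at h2
    exact absurd (h2.1 odd_one) (by simp)
  let S : Set V := Sum.inl ⁻¹' T
  have hTS : T.ncard = S.ncard + d := by
    have hT' : T = Sum.inl '' S ∪ Set.range Sum.inr := by
      ext (v | w)
      · simp [S]
      · simp [hW w]
    have h3 : (Set.range (Sum.inr : Fin d → V ⊕ Fin d)).ncard = d := by
      rw [← Set.image_univ, Set.ncard_image_of_injective _ Sum.inr_injective, Set.ncard_univ,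
        Nat.card_fin]
    rw [hT', Set.ncard_union_eq, Set.ncard_image_of_injective _ Sum.inl_injective, h3]
    rw [Set.disjoint_left]
    rintro _ ⟨v, -, rfl⟩ ⟨w, hw⟩
    exact Sum.inr_ne_inl hw
  have hSk : S.ncard ≤ k := by omega
  refine ⟨S, hSk, le_trans ?_ (card_adj_le_sq K (2 * (k - S.ncard) + 2) (by omega))⟩
  let φ : {p : V × V | G.Adj p.1 p.2 ∧ p.1 ∉ S ∧ p.2 ∉ S} →
      {p : _ × _ | K.Adj p.1 p.2} := fun p =>
    ⟨(⟨Sum.inl p.1.1, trivial, p.2.2.1⟩, ⟨Sum.inl p.1.2, trivial, p.2.2.2⟩),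
      SimpleGraph.Subgraph.deleteVerts_adj.2 ⟨trivial, p.2.2.1, trivial, p.2.2.2,
        joinComplete_adj_inl.2 p.2.1⟩⟩
  rw [← Nat.card_coe_set_eq, ← Nat.card_coe_set_eq]
  refine Nat.card_le_card_of_injective φ fun p p' hp => ?_
  have hp' := Prod.ext_iff.1 (Subtype.ext_iff.1 hp)
  exact Subtype.ext (Prod.ext (Sum.inl_injective (Subtype.ext_iff.1 hp'.1))
    (Sum.inl_injective (Subtype.ext_iff.1 hp'.2)))

/-! ### The optimisation problem and its two extremal functions -/

/-- The edge density, up to lower order terms, of the dense extremal graph. -/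
noncomputable def denseEdges (q : ℕ) (x : ℝ) : ℝ := 2 * (q - 1) * x + (4 - (q - 1) ^ 2) * x ^ 2

/-- The edge density, up to lower order terms, of the sparse extremal graph. -/
noncomputable def sparseEdges (q : ℕ) (x : ℝ) : ℝ := 1 - (1 - q * x) ^ 2

/-- With `τ = ∑ t i`, the sum of squares is at most `τ ^ 2` and at most `x * τ`. For `τ ≤ x` the
first bound gives a convex function of `τ`, maximal at `0` or `x`. For `τ ≥ x` the second gives a
function that is nonincreasing because `(q + 1) * x ≤ 1`. -/
theorem sum_sq_bound {q : ℕ} (x : ℝ) (hx : (q + 1) * x ≤ 1) (t : Fin q → ℝ)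
    (ht0 : ∀ i, 0 ≤ t i) (ht : ∀ i, t i ≤ x) :
    1 - (1 - (q * x - ∑ i, t i)) ^ 2 + 4 * ∑ i, t i ^ 2 ≤
      max (denseEdges q x) (sparseEdges q x) := by
  set τ := ∑ i, t i with hτ
  have hτ0 : 0 ≤ τ := Finset.sum_nonneg fun i _ => ht0 i
  have h1 : ∑ i, t i ^ 2 ≤ τ ^ 2 := Finset.sum_sq_le_sq_sum_of_nonneg fun i _ => ht0 i
  have h2 : ∑ i, t i ^ 2 ≤ x * τ := by
    rw [hτ, Finset.mul_sum]
    exact Finset.sum_le_sum fun i _ => by nlinarith [ht0 i, ht i]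
  unfold denseEdges sparseEdges
  rcases le_total τ x with h | h
  · rcases le_total (2 * (1 - q * x)) (3 * τ) with h3 | h3
    · refine le_max_of_le_left ?_
      nlinarith [mul_nonneg (sub_nonneg.2 h) (by linarith : 0 ≤ 3 * τ + 3 * x - 2 * (1 - q * x))]
    · refine le_max_of_le_right ?_
      nlinarith [mul_nonneg hτ0 (sub_nonneg.2 h3)]
  · refine le_max_of_le_left ?_
    nlinarith [mul_nonneg (sub_nonneg.2 h) (by linarith : 0 ≤ τ + x + 2 * (1 - q * x) - 4 * x)]

/-- Growth is only quadratic in general, since the derivative vanishes at `q * y = 1`. This is what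
turns a density error `O(1/n)` into an error `O(√n)` in the matching size. -/
theorem sq_sub_le_sparseEdges_sub {q : ℕ} (hq : 1 ≤ q) {x y : ℝ} (hxy : x ≤ y) (hy : q * y ≤ 1) :
    (y - x) ^ 2 ≤ sparseEdges q y - sparseEdges q x := by
  have hq' : (1 : ℝ) ≤ q := by exact_mod_cast hq
  unfold sparseEdges
  have h1 : y - x ≤ q * (y - x) := by nlinarith
  nlinarith [mul_nonneg (sub_nonneg.2 hy) (mul_nonneg (by linarith : (0 : ℝ) ≤ q) (sub_nonneg.2 hxy)),
    mul_self_le_mul_self (sub_nonneg.2 hxy) h1]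

theorem sq_sub_le_denseEdges_sub {q : ℕ} (hq : 1 ≤ q) {x y : ℝ} (hx : 0 ≤ x) (hxy : x ≤ y)
    (hy : (q + 1) * y ≤ 1) : (y - x) ^ 2 ≤ denseEdges q y - denseEdges q x := by
  unfold denseEdges
  -- The right side is the difference quotient of `denseEdges q`. Its second coefficient is `-(q -
  -- 3) * (q + 1)`, hence the case distinction on `q`.
  have key : y - x ≤ 2 * (q - 1) + (4 - (q - 1) ^ 2) * (x + y) := by
    rcases hq.eq_or_lt with rfl | hq
    · norm_num; linarith
    · have hq2 : (2 : ℝ) ≤ q := by exact_mod_cast hq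
      rcases lt_or_ge 2 q with h3 | h3
      · have hq3 : (3 : ℝ) ≤ q := by exact_mod_cast h3
        have : (q - 3 : ℝ) * ((q + 1) * (x + y)) ≤ (q - 3) * 2 :=
          mul_le_mul_of_nonneg_left (by nlinarith) (by linarith)
        nlinarith
      · obtain rfl : q = 2 := by omega
        norm_num at hy ⊢
        linarith
  nlinarith [mul_le_mul_of_nonneg_right key (sub_nonneg.2 hxy)]

theorem mul_sparse_le_one {q : ℕ} (hq : 1 ≤ q) (α : ℝ) : q * sparse q α ≤ 1 := by
  have hq' : (q : ℝ) ≠ 0 := by positivity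
  unfold sparse
  rw [mul_div_cancel₀ _ hq']
  linarith [Real.sqrt_nonneg (1 - α)]

theorem sparseEdges_sparse {q : ℕ} (hq : 1 ≤ q) {α : ℝ} (hα : α ≤ 1) :
    sparseEdges q (sparse q α) = α := by
  have hq' : (q : ℝ) ≠ 0 := by positivity
  unfold sparseEdges sparse
  rw [mul_div_cancel₀ _ hq', sub_sub_cancel, Real.sq_sqrt (by linarith)]
  ring

theorem dense_eq {q : ℕ} {α : ℝ} :
    dense q α = if q = 3 then α / 4 else denseExpr α q :=
  tendsto_nhds_unique (tendsto_dense q α) (tendsto_denseExpr_explicit q α)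

theorem dense_spec {q : ℕ} (hq : 1 ≤ q) {α : ℝ} (h0 : 0 ≤ α) (h1 : α ≤ 1) :
    (q + 1) * dense q α ≤ 1 ∧ denseEdges q (dense q α) = α := by
  have hq' : (1 : ℝ) ≤ q := by exact_mod_cast hq
  rw [dense_eq]
  split_ifs with h
  · subst h
    unfold denseEdges
    push_cast
    constructor
    · linarith
    · ring
  · have hq3 : (q : ℝ) - 3 ≠ 0 := sub_ne_zero.mpr (by exact_mod_cast h)
    have hd : (q : ℝ) ^ 2 - 2 * q - 3 = (q - 3) * (q + 1) := by ring
    -- The discriminant is a convex combination of `(q - 1) ^ 2` and `4`, so it is nonnegative, and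
    -- comparing its root with `2` gives the bound by `1 / (q + 1)`.
    have hD : (1 - 2 * (q : ℝ) + q ^ 2 - α * (q ^ 2 - 2 * q - 3))
        = (1 - α) * (q - 1) ^ 2 + α * 4 := by ring
    have hD0 : 0 ≤ (1 - 2 * (q : ℝ) + q ^ 2 - α * (q ^ 2 - 2 * q - 3)) := by
      rw [hD]; nlinarith [sq_nonneg ((q : ℝ) - 1)]
    unfold denseExpr
    set D := (1 - 2 * (q : ℝ) + q ^ 2 - α * (q ^ 2 - 2 * q - 3)) with hDdef
    have hs := Real.sq_sqrt hD0
    have hs0 := Real.sqrt_nonneg D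
    set s := √D
    have hne : (q : ℝ) ^ 2 - 2 * q - 3 ≠ 0 := by
      rw [hd]; exact mul_ne_zero hq3 (by linarith)
    constructor
    · rw [hd, mul_comm ((q : ℝ) - 3), ← mul_div_assoc, mul_div_mul_left _ _ (by linarith)]
      have hcmp : s ^ 2 - 2 ^ 2 = (1 - α) * ((q - 3) * (q + 1)) := by rw [hs, hD]; ring
      rcases lt_or_gt_of_ne hq3 with hlt | hgt
      · rw [div_le_one_of_neg hlt]
        have : s ^ 2 ≤ 2 ^ 2 := by
          nlinarith [mul_nonneg (sub_nonneg.2 h1)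
            (mul_nonneg (by linarith : (0 : ℝ) ≤ 3 - q) (by linarith : (0 : ℝ) ≤ q + 1))]
        have := abs_le_of_sq_le_sq' this (by norm_num)
        linarith
      · rw [div_le_one hgt]
        have : 2 ^ 2 ≤ s ^ 2 := by
          nlinarith [mul_nonneg (sub_nonneg.2 h1)
            (mul_nonneg hgt.le (by linarith : (0 : ℝ) ≤ q + 1))]
        have := le_of_sq_le_sq this hs0
        linarith
    · have hP : s ^ 2 = (q - 1) ^ 2 - α * (q ^ 2 - 2 * q - 3) := by rw [hs, hDdef]; ring
      have hy := div_mul_cancel₀ ((q : ℝ) - 1 - s) hne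
      set y := ((q : ℝ) - 1 - s) / (q ^ 2 - 2 * q - 3)
      unfold denseEdges
      refine mul_right_cancel₀ hne ?_
      linear_combination (q - 1 + s - y * (q ^ 2 - 2 * q - 3)) * hy - hP

/-! ### From a colouring to a bound on the edge density -/

theorem ncard_adj_eq_two_mul {V : Type*} [Finite V] (G : SimpleGraph V) :
    {p : V × V | G.Adj p.1 p.2}.ncard = 2 * G.edgeSet.ncard := by
  classical
  have := Fintype.ofFinite V
  rw [← SimpleGraph.coe_edgeFinset, Set.ncard_coe_finset, ← G.dart_card_eq_twice_card_edges,
    ← Nat.card_coe_set_eq, ← Nat.card_eq_fintype_card]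
  exact Nat.card_congr ⟨fun p => ⟨p.1, p.2⟩, fun d => ⟨d.1, d.2⟩, fun _ => rfl, fun _ => rfl⟩

/-- If no colour class of `G` has a matching of size `k + 1`, then `G` has few edges. -/
theorem exists_edge_bound {V : Type*} [Finite V] (G : SimpleGraph V) {q : ℕ}
    (C : G.EdgeLabeling (Fin q)) (k : ℕ)
    (hC : ∀ j, ¬ (matchingGraph (k + 1)).IsContained (C.labelGraph j)) :
    ∃ s : Fin q → ℕ, (∀ i, s i ≤ k) ∧
      2 * G.edgeSet.ncard + (Nat.card V - ∑ i, s i) ^ 2 ≤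
        Nat.card V ^ 2 + ∑ i, (2 * (k - s i) + 2) ^ 2 := by
  choose S hSk hS using fun j => exists_cover_of_not_isContained (C.labelGraph j) k (hC j)
  refine ⟨fun i => (S i).ncard, hSk, ?_⟩
  let D : Fin q → Set (V × V) :=
    fun i => {p | (C.labelGraph i).Adj p.1 p.2 ∧ p.1 ∉ S i ∧ p.2 ∉ S i}
  let U : Set V := ⋃ i, S i
  have hU : U.ncard ≤ ∑ i, (S i).ncard := Set.ncard_iUnion_le_of_fintype _
  have hcover : {p : V × V | G.Adj p.1 p.2} ⊆ (Uᶜ ×ˢ Uᶜ)ᶜ ∪ ⋃ i, D i := by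
    rintro ⟨u, v⟩ huv
    by_cases hp : (u, v) ∈ Uᶜ ×ˢ Uᶜ
    · obtain ⟨hu, hv⟩ := hp
      simp only [U, Set.mem_compl_iff, Set.mem_iUnion, not_exists] at hu hv
      exact Or.inr (Set.mem_iUnion.2 ⟨C ⟨s(u, v), huv⟩,
        (SimpleGraph.EdgeLabeling.labelGraph_adj u v).2 ⟨huv, rfl⟩, hu _, hv _⟩)
    · exact Or.inl hp
  have h1 : 2 * G.edgeSet.ncard ≤ (Uᶜ ×ˢ Uᶜ)ᶜ.ncard + ∑ i, (2 * (k - (S i).ncard) + 2) ^ 2 := by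
    rw [← ncard_adj_eq_two_mul]
    refine (Set.ncard_le_ncard hcover).trans ((Set.ncard_union_le _ _).trans ?_)
    refine Nat.add_le_add_left ((Set.ncard_iUnion_le_of_fintype _).trans ?_) _
    exact Finset.sum_le_sum fun i _ => hS i
  have h2 : (Uᶜ ×ˢ Uᶜ).ncard + (Uᶜ ×ˢ Uᶜ)ᶜ.ncard = Nat.card V ^ 2 := by
    rw [Set.ncard_add_ncard_compl, Nat.card_prod, sq]
  -- The sets may overlap, so the sum only bounds the size of their union from above; truncated
  -- subtraction is harmless here.
  have h3 : (Nat.card V - ∑ i, (S i).ncard) ^ 2 ≤ (Uᶜ ×ˢ Uᶜ).ncard := by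
    rw [Set.ncard_prod, ← sq]
    have := Set.ncard_add_ncard_compl U
    exact Nat.pow_le_pow_left (by omega) 2
  beta_reduce
  omega

theorem density_bound {V : Type*} [Finite V] (G : SimpleGraph V) {q : ℕ} (hq : 1 ≤ q)
    {α : ℝ} (hα : α ≤ 1) (he : (G.edgeSet.ncard : ℝ) = α * ((Nat.card V).choose 2 : ℝ))
    (hk : (q + 1) * nu q G < Nat.card V) :
    α ≤ max (denseEdges q (nu q G / Nat.card V)) (sparseEdges q (nu q G / Nat.card V)) +
      (12 * q + 1) / Nat.card V := by
  have hnot : ¬ Arrows G q (matchingGraph (nu q G + 1)) := fun h =>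
    absurd ((isGreatest_nu q hq G).2 h) (by omega)
  unfold Arrows at hnot
  push Not at hnot
  obtain ⟨C, hC⟩ := hnot
  obtain ⟨s, hs, hbound⟩ := exists_edge_bound G C (nu q G) fun j => not_nonempty_iff.2 (hC j)
  set k := nu q G
  set n := Nat.card V
  have hσ : ∑ i, s i ≤ n := by
    have : ∑ i, s i ≤ q * k := by
      simpa using Finset.sum_le_sum fun i (_ : i ∈ Finset.univ) => hs i
    nlinarith
  have hn1 : 1 ≤ n := by omega
  have hn : (0 : ℝ) < n := by exact_mod_cast hn1
  have hkn : (k : ℝ) ≤ n := by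
    have : k ≤ n := by nlinarith
    exact_mod_cast this
  have hkq : ((q : ℝ) + 1) * k ≤ n := by exact_mod_cast hk.le
  have hbound' : 2 * (G.edgeSet.ncard : ℝ) + (n - ∑ i, (s i : ℝ)) ^ 2 ≤
      n ^ 2 + ∑ i, (2 * (k - (s i : ℝ)) + 2) ^ 2 := by
    have h : ((2 * G.edgeSet.ncard + (n - ∑ i, s i) ^ 2 : ℕ) : ℝ) ≤
      (n ^ 2 + ∑ i, (2 * (k - s i) + 2) ^ 2 : ℕ) := by exact_mod_cast hbound
    push_cast [Nat.cast_sub hσ, fun i => Nat.cast_sub (R := ℝ) (hs i)] at h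
    exact h
  let t : Fin q → ℝ := fun i => (k - s i) / n
  have hs' : ∀ i, (s i : ℝ) ≤ k := fun i => by exact_mod_cast hs i
  have hsum := sum_sq_bound (q := q) (k / n : ℝ) (by rw [← mul_div_assoc, div_le_one hn]; exact hkq) t
    (fun i => div_nonneg (sub_nonneg.2 (hs' i)) hn.le)
    (fun i => div_le_div_of_nonneg_right (by simp) hn.le)
  have ht1 : q * (k / n : ℝ) - ∑ i, t i = (∑ i, (s i : ℝ)) / n := by
    simp only [t, ← Finset.sum_div, Finset.sum_sub_distrib, Finset.sum_const, Finset.card_univ,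
      Fintype.card_fin, nsmul_eq_mul]
    ring
  have ht2 : ∑ i, (2 * (k - (s i : ℝ)) + 2) ^ 2 ≤ n ^ 2 * (4 * ∑ i, t i ^ 2) + 12 * q * n := by
    -- Here `8 * (k - s i) + 4 ≤ 12 * n`. The remaining `1` in `12 * q + 1` pays for replacing `n *
    -- (n - 1)` by `n ^ 2`.
    have : ∀ i ∈ Finset.univ, (2 * (k - (s i : ℝ)) + 2) ^ 2 ≤ n ^ 2 * (4 * t i ^ 2) + 12 * n := by
      intro i _
      have h1 : (n : ℝ) ^ 2 * (4 * t i ^ 2) = 4 * (k - s i) ^ 2 := by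
        simp only [t]; field_simp
      have h2 : (1 : ℝ) ≤ n := by exact_mod_cast hn1
      have h3 : (0 : ℝ) ≤ s i := Nat.cast_nonneg _
      rw [h1]
      nlinarith
    refine (Finset.sum_le_sum this).trans_eq ?_
    rw [Finset.sum_add_distrib, ← Finset.mul_sum, ← Finset.mul_sum]
    simp
    ring
  rw [ht1] at hsum
  rw [he, Nat.cast_choose_two] at hbound'
  refine le_trans ?_ (add_le_add_left hsum _)
  refine le_of_mul_le_mul_left ?_ (pow_pos hn 2)
  have h4 : (n : ℝ) ^ 2 * (1 - (1 - (∑ i, (s i : ℝ)) / n) ^ 2 + 4 * ∑ i, t i ^ 2 +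
      (12 * q + 1) / n) = n ^ 2 - (n - ∑ i, (s i : ℝ)) ^ 2 + n ^ 2 * (4 * ∑ i, t i ^ 2) +
        (12 * q + 1) * n := by
    field_simp
  rw [h4]
  nlinarith

theorem isLittleO_sqrt_mul (c : ℝ) :
    (fun n : ℕ => √(c * n)) =o[atTop] (fun n : ℕ => (n : ℝ)) := by
  have h : (fun n : ℕ => √(n : ℝ)) =o[atTop] (fun n : ℕ => (n : ℝ)) := by
    refine Asymptotics.isLittleO_of_tendsto (fun n hn => by rw [hn, Real.sqrt_zero]) ?_
    simp only [Real.sqrt_div_self]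
    exact (Real.tendsto_sqrt_atTop.comp tendsto_natCast_atTop_atTop).inv_tendsto_atTop
  simpa only [Real.sqrt_mul' c (Nat.cast_nonneg _)] using h.const_mul_left √c

end MatchingRamsey

/-- The error term `err` depends on the number of colours `q` and the number of vertices only. -/
theorem mainTheorem3 (q : ℕ) (hq : 1 ≤ q) :
    ∃ err : ℕ → ℝ, Asymptotics.IsLittleO Filter.atTop err (fun n : ℕ => (n : ℝ)) ∧
      ∀ (V : Type*) [Fintype V] (G : SimpleGraph V) (α : ℝ), 0 ≤ α → α ≤ 1 →
        (G.edgeSet.ncard : ℝ) = α * ((Fintype.card V).choose 2 : ℝ) →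
        min (MatchingRamsey.sparse q α) (MatchingRamsey.dense q α) * (Fintype.card V : ℝ) - err (Fintype.card V)
          ≤ (MatchingRamsey.nu q G : ℝ) := by
  refine ⟨fun n => √((12 * q + 1) * n), MatchingRamsey.isLittleO_sqrt_mul _, ?_⟩
  intro V _ G α h0 h1 he
  rw [← Nat.card_eq_fintype_card] at he ⊢
  obtain ⟨hd1, hd2⟩ := MatchingRamsey.dense_spec hq h0 h1
  have hs1 := MatchingRamsey.mul_sparse_le_one hq α
  have hs2 := MatchingRamsey.sparseEdges_sparse hq h1
  set y := MatchingRamsey.dense q α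
  set z := MatchingRamsey.sparse q α
  have hsqrt := Real.sqrt_nonneg ((12 * q + 1) * (Nat.card V : ℝ))
  have hn0 : (0 : ℝ) ≤ Nat.card V := Nat.cast_nonneg _
  have hk0 : (0 : ℝ) ≤ MatchingRamsey.nu q G := Nat.cast_nonneg _
  have hmy := mul_le_mul_of_nonneg_right (min_le_right z y) hn0
  have hmz := mul_le_mul_of_nonneg_right (min_le_left z y) hn0
  -- If `n ≤ (q + 1) * k`, then `dense q α ≤ 1 / (q + 1)` already suffices; otherwise `x = k / n`
  -- lies in the range where the optimisation applies.
  rcases le_or_gt (Nat.card V) ((q + 1) * MatchingRamsey.nu q G) with hk | hk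
  · have hk' : (Nat.card V : ℝ) ≤ (q + 1) * MatchingRamsey.nu q G := by exact_mod_cast hk
    have hyn := mul_le_mul_of_nonneg_right hd1 hn0
    have : y * Nat.card V ≤ MatchingRamsey.nu q G :=
      le_of_mul_le_mul_left (by linarith) (by positivity : (0 : ℝ) < q + 1)
    linarith
  · have hb := MatchingRamsey.density_bound G hq h1 he hk
    have hn : (0 : ℝ) < Nat.card V := by
      have : 0 < Nat.card V := by omega
      exact_mod_cast this
    have key : ∀ w : ℝ, ((MatchingRamsey.nu q G : ℝ) / Nat.card V ≤ w →
        (w - MatchingRamsey.nu q G / Nat.card V) ^ 2 ≤ (12 * q + 1) / Nat.card V) →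
        w * Nat.card V - √((12 * q + 1) * (Nat.card V : ℝ)) ≤ MatchingRamsey.nu q G := by
      intro w hw
      rcases le_total ((MatchingRamsey.nu q G : ℝ) / Nat.card V) w with h | h
      · have h2 : (w * Nat.card V - MatchingRamsey.nu q G) ^ 2 ≤ (12 * q + 1) * Nat.card V := by
          have h3 := mul_le_mul_of_nonneg_left (hw h) (sq_nonneg (Nat.card V : ℝ))
          have h4 : (Nat.card V : ℝ) ^ 2 * (w - MatchingRamsey.nu q G / Nat.card V) ^ 2
              = (w * Nat.card V - MatchingRamsey.nu q G) ^ 2 := by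
            rw [← mul_pow]; congr 1; field_simp
          have h5 : (Nat.card V : ℝ) ^ 2 * ((12 * q + 1) / Nat.card V)
              = (12 * q + 1) * Nat.card V := by field_simp
          rwa [h4, h5] at h3
        have := Real.le_sqrt_of_sq_le h2
        linarith
      · rw [le_div_iff₀ hn] at h
        linarith
    have hx : (0 : ℝ) ≤ (MatchingRamsey.nu q G : ℝ) / Nat.card V := div_nonneg hk0 hn0
    rcases le_total (MatchingRamsey.denseEdges q (MatchingRamsey.nu q G / Nat.card V))
      (MatchingRamsey.sparseEdges q (MatchingRamsey.nu q G / Nat.card V)) with h | h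
    · rw [max_eq_right h] at hb
      have := key z fun hz => by
        linarith [MatchingRamsey.sq_sub_le_sparseEdges_sub hq hz hs1]
      linarith
    · rw [max_eq_left h] at hb
      have := key y fun hy => by
        linarith [MatchingRamsey.sq_sub_le_denseEdges_sub hq hx hy hd1]
      linarith
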